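/- Let $n\ge 1$, and let $q,a,x_1,\dots,x_n$ be complex numbers with $0<|q|<1$. Write $(A)_0=1$ and $(A)_k=(1-A)(1-Aq)\cdots(1-Aq^{k-1})$ for integers $k\ge 1$, and for a multi-index $\boldsymbol m=(m_1,\dots,m_n)$ of non-negative integers write $|\boldsymbol m|=m_1+\cdots+m_n$. Assume that $x_r\neq 0$ for all $r$, that $x_rq^{j}\ne x_s$ for all $r\neq s$ and all integers $j\ge 0$, and that $ax_rq^{j}\neq 1$ for all $r$ and all integers $j\ge 0$ (that is, no denominator below vanishes). For multi-indices $\boldsymbol k,\boldsymbol m$ put $$F_{\boldsymbol k\boldsymbol m}(a)=\prod_{1\le r<s\le n}\frac{1-q^{m_r-m_s}x_r/x_s}{1-x_r/x_s}\; q^{\sum_{r=1}^n (r-1)m_r}\,q^{|\boldsymbol k||\boldsymbol m|}\prod_{r,s=1}^n\bigl(q^{-k_s}x_r/x_s\bigr)_{m_r}\prod_{r=1}^n\frac{1-ax_rq^{m_r+|\boldsymbol m|}}{(ax_rq^{k_r+1})_{|\boldsymbol m|}}$$ and $$G_{\boldsymbol k\boldsymbol m}(a)=\prod_{1\le r<s\le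 n}\frac{1-q^{m_r-m_s}x_r/x_s}{1-x_r/x_s}\; q^{\sum_{r=1}^n r m_r}\prod_{r,s=1}^n\frac{\bigl(q^{-k_s}x_r/x_s\bigr)_{m_r}}{(qx_r/x_s)_{k_r}\,(qx_r/x_s)_{m_r}}\prod_{r=1}^n\frac{(ax_rq^{m_r})_{|\boldsymbol k|}}{1-ax_rq^{m_r}}.$$ Then $F_{\boldsymbol k\boldsymbol m}(a)=G_{\boldsymbol k\boldsymbol m}(a)=0$ unless $m_r\le k_r$ for all $r=1,\dots,n$; in particular both matrices are lower-triangular when the multi-indices are ordered lexicographically. Moreover, the matrices $\boldsymbol F=(F_{\boldsymbol k\boldsymbol m}(a))$ and $\boldsymbol G=(G_{\boldsymbol k\boldsymbol m}(a))$ are inverses of each other: for all multi-indices $\boldsymbol k,\boldsymbol m$, $$\sum_{\boldsymbol l}F_{\boldsymbol k\boldsymbol l}(a)\,G_{\boldsymbol l\boldsymbol m}(a)=\delta_{\boldsymbol k\boldsymbol m}\qquad\text{and}\qquad \sum_{\boldsymbol l}G_{\boldsymbol k\boldsymbol l}(a)\,F_{\boldsymbol l\boldsymbol m}(a)=\delta_{\boldsymbol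 k\boldsymbol m},$$ where the sums run over all multi-indices $\boldsymbol l$ and have only finitely many nonzero terms. -/

import Mathlib

noncomputable section

/-- The `q`-rising factorial `(A; q)_k = (1 - A)(1 - A q) ⋯ (1 - A q^(k-1))`, with `(A; q)_0 = 1`. -/
def qRising (q A : ℂ) (k : ℕ) : ℂ :=
  ∏ i ∈ Finset.range k, (1 - A * q ^ i)

/-- The size `|m| = m_1 + ⋯ + m_n` of a multi-index. -/
def multiSize {n : ℕ} (m : Fin n → ℕ) : ℕ := ∑ r, m r

/-- The Vandermonde factor of type `A`,
`∏_{1 ≤ r < s ≤ n} (1 - q^(m_r - m_s) x_r / x_s) / (1 - x_r / x_s)`. -/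
def vandermondeA {n : ℕ} (q : ℂ) (x : Fin n → ℂ) (m : Fin n → ℕ) : ℂ :=
  ∏ r : Fin n, ∏ s ∈ Finset.Ioi r,
    (1 - q ^ ((m r : ℤ) - (m s : ℤ)) * (x r / x s)) / (1 - x r / x s)

/-- The matrix `F(a)`, with rows `k` and columns `m` indexed by multi-indices. The indices
`r ∈ {1, …, n}` are the elements of `Fin n` shifted by one, so that the power
`q^(∑ (r - 1) m_r)` reads `q ^ ∑ r, (r : ℕ) * m r`. -/
def baileyF {n : ℕ} (q a : ℂ) (x : Fin n → ℂ) : Matrix (Fin n → ℕ) (Fin n → ℕ) ℂ :=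
  fun k m =>
    vandermondeA q x m * q ^ (∑ r : Fin n, (r : ℕ) * m r) * q ^ (multiSize k * multiSize m)
      * (∏ r : Fin n, ∏ s : Fin n, qRising q (q ^ (-(k s : ℤ)) * (x r / x s)) (m r))
      * ∏ r : Fin n, (1 - a * x r * q ^ (m r + multiSize m))
          / qRising q (a * x r * q ^ (k r + 1)) (multiSize m)

/-- The matrix `G(a)`, with rows `k` and columns `m` indexed by multi-indices. The power
`q^(∑ r m_r)`, with `r ∈ {1, …, n}`, reads `q ^ ∑ r, ((r : ℕ) + 1) * m r`. -/
def baileyG {n : ℕ} (q a : ℂ) (x : Fin n → ℂ) : Matrix (Fin n → ℕ) (Fin n → ℕ) ℂ :=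
  fun k m =>
    vandermondeA q x m * q ^ (∑ r : Fin n, ((r : ℕ) + 1) * m r)
      * (∏ r : Fin n, ∏ s : Fin n,
          qRising q (q ^ (-(k s : ℤ)) * (x r / x s)) (m r)
            / (qRising q (q * (x r / x s)) (k r) * qRising q (q * (x r / x s)) (m r)))
      * ∏ r : Fin n, qRising q (a * x r * q ^ (m r)) (multiSize k)
          / (1 - a * x r * q ^ (m r))

/-- The matrix product `A B` of two possibly infinite matrices is the identity matrix: every sum
`∑_l A_{il} B_{lj}` has only finitely many nonzero terms, and its value is `δ_{ij}`. -/
def MulEqOne {I : Type*} [DecidableEq I] (A B : Matrix I I ℂ) : Prop :=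
  ∀ i j, (Function.support fun l => A i l * B l j).Finite ∧
    ∑ᶠ l, A i l * B l j = (1 : Matrix I I ℂ) i j

/-- Lower triangularity of a multi-indexed matrix, in the componentwise sense: `A_{km} = 0` unless
`m_r ≤ k_r` for all `r`. -/
def MultiLowerTriangular {n : ℕ} (A : Matrix (Fin n → ℕ) (Fin n → ℕ) ℂ) : Prop :=
  ∀ k m, ¬ (∀ r, m r ≤ k r) → A k m = 0

/-- Lower triangularity of a multi-indexed matrix with respect to the lexicographic order of the
multi-indices. -/
def LexLowerTriangular {n : ℕ} (A : Matrix (Fin n → ℕ) (Fin n → ℕ) ℂ) : Prop :=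
  ∀ k m, toLex k < toLex m → A k m = 0

end

/-!
Since both matrices are lower triangular and the index set is locally finite, it is enough to show
`G F = 1` (`mulEqOne_and_swap_of_multiLowerTriangular`).

Fix `m ≤ k` with `m ≠ k`, and put `y_s = x_s q^{l_s}`. As a function of `l`, the product
`G_{kl} F_{lm}` is a constant times
`∏_{r<s} (y_s - y_r) · ∏_s w_s(l_s) P(y_s)`,
where `P` is a polynomial of one variable of degree at most `|k| - 1` and `w_s(l)` is proportional,
for each `s`, to the Lagrange weight of `x_s q^l` among the `n + |k|` nodes `x_t q^j`, `0 ≤ j ≤ k_t`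
(`baileyG_mul_baileyF_eq`, `nodeWeight_eq_div`). Summing a Vandermonde determinant against product
weights over a box gives one determinant, with entries `∑_l w_s(l) P(x_s q^l) (x_s q^l)^j` for
`0 ≤ j < n`. A suitable linear combination of its rows is the divided difference of `P X^j` at all
the nodes; it vanishes because `P X^j` has degree at most `n + |k| - 2`. Hence the determinant
is zero (`sum_nodeWeight_mul_det_vandermonde_eq_zero`).

For `m = k` only the term `l = k` survives, and it is evaluated by reversing rising factorials
(`baileyG_mul_baileyF_diag`).
-/

/-! ### Vanishing determinants and truncation of triangular matrices -/

open Polynomial in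
/-- The divided difference of a polynomial of degree at most `#s - 2` at the `#s` nodes `v i`
vanishes: it is the coefficient of `X ^ (#s - 1)` in the interpolation polynomial. -/
theorem sum_lagrange_weight_eq_zero {ι K : Type*} [Field K] [DecidableEq ι]
    {s : Finset ι} {v : ι → K} (hv : Set.InjOn v s) {P : K[X]} (hP : P.natDegree + 1 < s.card) :
    ∑ i ∈ s, P.eval (v i) / ∏ j ∈ s.erase i, (v i - v j) = 0 := by
  rw [← Lagrange.coeff_eq_sum hv]
  · exact coeff_eq_zero_of_natDegree_lt (by omega)
  · exact degree_le_natDegree.trans_lt (by exact_mod_cast (by omega))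

theorem prod_sigma_erase {ι κ K : Type*} [CommMonoid K] [Fintype ι] [DecidableEq ι]
    [DecidableEq κ] (A : ι → Finset κ) (f : ι → κ → K) (s : ι) (l : κ) :
    ∏ p ∈ (Finset.univ.sigma A).erase (⟨s, l⟩ : Σ _ : ι, κ), f p.1 p.2
      = (∏ j ∈ (A s).erase l, f s j) * ∏ t ∈ {s}ᶜ, ∏ j ∈ A t, f t j := by
  have h : (Finset.univ.sigma A).erase (⟨s, l⟩ : Σ _ : ι, κ)
      = Finset.univ.sigma (fun t => if t = s then (A s).erase l else A t) := by
    ext ⟨t, j⟩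
    by_cases hts : t = s
    · subst hts; simp
    · simp [hts]
  rw [h, Finset.prod_sigma, Fintype.prod_eq_mul_prod_compl s]
  congr 1
  · simp
  · refine Finset.prod_congr rfl fun t ht => ?_
    rw [if_neg (by simpa using ht)]

/-- A sum over a box of Vandermonde determinants with product weights is, by multilinearity in
the rows, a single determinant; the hypothesis says that its rows are linearly dependent. -/
theorem sum_piFinset_det_vandermonde_eq_zero {K : Type*} [Field K] {n : ℕ}
    (A : Fin n → Finset ℕ) (y w : Fin n → ℕ → K) {c : Fin n → K} (hc : c ≠ 0)
    (h : ∀ j < n, ∑ s, c s * ∑ l ∈ A s, w s l * y s l ^ j = 0) :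
    ∑ l ∈ Fintype.piFinset A,
      (∏ s, w s (l s)) * (Matrix.vandermonde fun s => y s (l s)).det = 0 := by
  have hdet : (Matrix.of fun s (j : Fin n) => ∑ l ∈ A s, w s l * y s l ^ (j : ℕ)).det = 0 := by
    rw [← Matrix.exists_vecMul_eq_zero_iff]
    refine ⟨c, hc, funext fun j => ?_⟩
    simpa [Matrix.vecMul, dotProduct] using h j j.2
  rw [← hdet]
  have := (Matrix.detRowAlternating (R := K) (n := Fin n)).toMultilinearMap.map_sum_finset
    (fun s l => w s l • fun j : Fin n => y s l ^ (j : ℕ)) A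
  simp only [MultilinearMap.map_smul_univ] at this
  have h2 : (Matrix.of fun s (j : Fin n) => ∑ l ∈ A s, w s l * y s l ^ (j : ℕ))
      = fun s => ∑ l ∈ A s, w s l • fun j : Fin n => y s l ^ (j : ℕ) := by
    ext s j
    simp [Finset.sum_apply]
  rw [h2]
  exact this.symm

/-- For lower triangular matrices a right inverse is a left inverse: the entry at `(i, j)` only
involves indices below `i ⊔ j`, and the truncations to these are finite square matrices. -/
theorem mulEqOne_and_swap_of_multiLowerTriangular {n : ℕ}
    {A B : Matrix (Fin n → ℕ) (Fin n → ℕ) ℂ} (hA : MultiLowerTriangular A)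
    (hB : MultiLowerTriangular B)
    (h : ∀ i j, ∑ l ∈ Finset.Iic i, A i l * B l j = (1 : Matrix (Fin n → ℕ) (Fin n → ℕ) ℂ) i j) :
    MulEqOne A B ∧ MulEqOne B A := by
  have key : ∀ {A B : Matrix (Fin n → ℕ) (Fin n → ℕ) ℂ}, MultiLowerTriangular A →
      ∀ i j, (Function.support fun l => A i l * B l j) ⊆ ↑(Finset.Iic i) := by
    intro A B hA i j l hl
    by_contra hli
    refine hl ?_
    simp only [hA i l (fun h' => hli (Finset.mem_coe.2 (Finset.mem_Iic.2 h'))), zero_mul]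
  have fin : ∀ {A B : Matrix (Fin n → ℕ) (Fin n → ℕ) ℂ}, MultiLowerTriangular A →
      (∀ i j, ∑ l ∈ Finset.Iic i, A i l * B l j = (1 : Matrix _ _ ℂ) i j) → MulEqOne A B := by
    intro A B hA h i j
    refine ⟨(Finset.finite_toSet _).subset (key hA i j), ?_⟩
    rw [finsum_eq_sum_of_support_subset _ (key hA i j), h]
  refine ⟨fin hA h, fin hB fun i j => ?_⟩
  have ext_sum : ∀ {A B : Matrix (Fin n → ℕ) (Fin n → ℕ) ℂ}, MultiLowerTriangular A →
      ∀ i' ≤ i ⊔ j, ∀ j', ∑ l : Finset.Iic (i ⊔ j), A i' l * B l j'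
        = ∑ l ∈ Finset.Iic i', A i' l * B l j' := by
    intro A B hA i' hi' j'
    rw [Finset.sum_coe_sort (Finset.Iic (i ⊔ j)) (fun l => A i' l * B l j')]
    symm
    apply Finset.sum_subset (Finset.Iic_subset_Iic.2 hi')
    intro l _ hl
    rw [hA i' l (fun h' => hl (Finset.mem_Iic.2 h')), zero_mul]
  have hAB : A.submatrix (Subtype.val : Finset.Iic (i ⊔ j) → _) Subtype.val
      * B.submatrix Subtype.val (Subtype.val : Finset.Iic (i ⊔ j) → _) = 1 := by
    ext i' j'
    rw [Matrix.mul_apply]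
    simp only [Matrix.submatrix_apply]
    rw [ext_sum hA _ (Finset.mem_Iic.1 i'.2), h]
    simp only [Matrix.one_apply, Subtype.ext_iff]
  rw [mul_eq_one_comm] at hAB
  have := congrFun (congrFun hAB ⟨i, Finset.mem_Iic.2 le_sup_left⟩)
    ⟨j, Finset.mem_Iic.2 le_sup_right⟩
  rw [Matrix.mul_apply] at this
  simp only [Matrix.submatrix_apply] at this
  rw [ext_sum hB _ le_sup_left] at this
  rw [this]
  simp [Matrix.one_apply]

theorem MultiLowerTriangular.lexLowerTriangular {n : ℕ}
    {A : Matrix (Fin n → ℕ) (Fin n → ℕ) ℂ} (hA : MultiLowerTriangular A) :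
    LexLowerTriangular A := fun k m hkm =>
  hA k m fun h => (Pi.toLex_monotone (show m ≤ k from h)).not_gt hkm

/-! ### Rising factorials and geometric progressions -/

theorem qRising_zero (q A : ℂ) : qRising q A 0 = 1 := by simp [qRising]

theorem qRising_succ (q A : ℂ) (k : ℕ) :
    qRising q A (k + 1) = qRising q A k * (1 - A * q ^ k) := Finset.prod_range_succ _ _

theorem qRising_add (q A : ℂ) (k l : ℕ) :
    qRising q A (k + l) = qRising q A k * qRising q (A * q ^ k) l := by
  simp only [qRising, Finset.prod_range_add, pow_add, mul_assoc]

theorem qRising_ne_zero {q A : ℂ} {k : ℕ} (h : ∀ i < k, A * q ^ i ≠ 1) : qRising q A k ≠ 0 :=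
  Finset.prod_ne_zero_iff.2 fun i hi => sub_ne_zero.2 (h i (Finset.mem_range.1 hi)).symm

theorem qRising_zpow_neg_eq_zero {q : ℂ} (hq : q ≠ 0) {k m : ℕ} (h : k < m) :
    qRising q (q ^ (-(k : ℤ))) m = 0 := by
  refine Finset.prod_eq_zero (Finset.mem_range.2 h) ?_
  rw [zpow_neg, zpow_natCast, inv_mul_cancel₀ (pow_ne_zero _ hq), sub_self]

/-- Reversal of the factors of `(A)_k`, that is `i ↦ k - 1 - i`. -/
theorem qRising_reverse {q A : ℂ} (hq : q ≠ 0) (hA : A ≠ 0) (k : ℕ) :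
    qRising q A k = (-A) ^ k * q ^ (∑ i ∈ Finset.range k, i)
      * qRising q (q ^ (1 - (k : ℤ)) * A⁻¹) k := by
  simp only [qRising]
  rw [← Finset.prod_range_reflect (fun i => 1 - q ^ (1 - (k : ℤ)) * A⁻¹ * q ^ i),
    ← Finset.prod_pow_eq_pow_sum, ← Finset.card_range k, ← Finset.prod_const, Finset.card_range,
    ← Finset.prod_mul_distrib, ← Finset.prod_mul_distrib]
  refine Finset.prod_congr rfl fun i hi => ?_
  have hi := Finset.mem_range.1 hi
  have h : q ^ (1 - (k : ℤ)) * q ^ (k - 1 - i) * q ^ i = 1 := by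
    rw [← zpow_natCast q (k - 1 - i), ← zpow_natCast q i, ← zpow_add₀ hq, ← zpow_add₀ hq]
    rw [show 1 - (k : ℤ) + ((k - 1 - i : ℕ) : ℤ) + i = 0 by omega, zpow_zero]
  have hAA : A * A⁻¹ = 1 := mul_inv_cancel₀ hA
  linear_combination (-(A * A⁻¹)) * h - hAA

/-- Up to a factor independent of `l`, the product of the differences between `y q^l` and the
progression `z, z q, …, z q^K` is a quotient of rising factorials. No power of `q` appears. -/
theorem prod_sub_geom_mul_qRising {q z : ℂ} (hq : q ≠ 0) (hz : z ≠ 0) (K : ℕ) (y : ℂ) (l : ℕ) :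
    (∏ j ∈ Finset.range (K + 1), (y * q ^ l - z * q ^ j))
        * qRising q (q ^ (-(K : ℤ)) * (y / z)) l
      = qRising q (q * (y / z)) l * ∏ j ∈ Finset.range (K + 1), (y - z * q ^ j) := by
  have step : ∀ y : ℂ, (∏ j ∈ Finset.range (K + 1), (y * q - z * q ^ j))
        * (1 - q ^ (-(K : ℤ)) * (y / z))
      = (1 - q * (y / z)) * ∏ j ∈ Finset.range (K + 1), (y - z * q ^ j) := by
    intro y
    rw [Finset.prod_range_succ', Finset.prod_range_succ]
    have : ∀ j, y * q - z * q ^ (j + 1) = q * (y - z * q ^ j) := fun j => by ring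
    simp only [this, Finset.prod_mul_distrib, Finset.prod_const, Finset.card_range]
    rw [zpow_neg, zpow_natCast]
    field_simp
    ring
  induction l with
  | zero => simp [qRising_zero]
  | succ l ih =>
    have := step (y * q ^ l)
    rw [qRising_succ, qRising_succ, pow_succ]
    simp only [← mul_assoc] at this ⊢
    linear_combination qRising q (q ^ (-(K : ℤ)) * (y / z)) l * this
      + (1 - q * (y / z) * q ^ l) * ih

/-- The analogue of `prod_sub_geom_mul_qRising` for a point `z q^l` of the progression itself,
whose own factor is omitted. The omission is what produces the power `q ^ l`. -/
theorem prod_erase_sub_geom_mul_qRising {q z : ℂ} (hq : q ≠ 0) {K l : ℕ} (hl : l ≤ K) :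
    (∏ j ∈ (Finset.range (K + 1)).erase l, (z * q ^ l - z * q ^ j))
        * (q ^ l * qRising q (q ^ (-(K : ℤ))) l)
      = qRising q q l * ∏ j ∈ (Finset.range (K + 1)).erase 0, (z - z * q ^ j) := by
  induction l with
  | zero => simp [qRising_zero]
  | succ l ih =>
    have ih := ih (by omega)
    have e1 : (Finset.range (K + 1)).erase (l + 1)
        = insert 0 (((Finset.range K).erase l).map ⟨Nat.succ, Nat.succ_injective⟩) := by
      ext j
      cases j <;> simp
    have e2 : (Finset.range (K + 1)).erase l = insert K ((Finset.range K).erase l) := by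
      ext j
      simp
      omega
    have step : (∏ j ∈ (Finset.range (K + 1)).erase (l + 1), (z * q ^ (l + 1) - z * q ^ j))
          * (q * (1 - q ^ (-(K : ℤ)) * q ^ l))
        = (1 - q * q ^ l) * ∏ j ∈ (Finset.range (K + 1)).erase l, (z * q ^ l - z * q ^ j) := by
      rw [e1, e2, Finset.prod_insert (by simp), Finset.prod_insert (by simp), Finset.prod_map]
      have : ∀ j, z * q ^ (l + 1) - z * q ^ (j + 1) = q * (z * q ^ l - z * q ^ j) :=
        fun j => by ring
      simp only [Function.Embedding.coeFn_mk, Nat.succ_eq_add_one, this, Finset.prod_mul_distrib,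
        Finset.prod_const]
      rw [Finset.card_erase_of_mem (Finset.mem_range.2 (by omega)), Finset.card_range]
      obtain ⟨K, rfl⟩ : ∃ K', K = K' + 1 := ⟨K - 1, by omega⟩
      rw [zpow_neg, zpow_natCast, Nat.add_sub_cancel]
      field_simp
      ring
    rw [qRising_succ, qRising_succ]
    rw [pow_succ q l] at step ⊢
    linear_combination q ^ l * qRising q (q ^ (-(K : ℤ))) l * step + (1 - q * q ^ l) * ih

/-! ### The nodes `x_s q^l` and their Lagrange weights -/

/-- The contribution of one coordinate `l = l_s` to `G_{kl}`, the Vandermonde determinant in the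
`x_s q^{l_s}` and the `a`-dependent factors being set aside: `q^l ∏_t (q^{-k_t} x_s / x_t)_l / (q x_s / x_t)_l`. -/
noncomputable def nodeWeight {n : ℕ} (q : ℂ) (x : Fin n → ℂ) (k : Fin n → ℕ) (s : Fin n) (l : ℕ) : ℂ :=
  q ^ l * ∏ t, qRising q (q ^ (-(k t : ℤ)) * (x s / x t)) l / qRising q (q * (x s / x t)) l

/-- Labels `(t, j)`, `0 ≤ j ≤ k_t`, of the `n + |k|` interpolation nodes `x_t q^j`. -/
noncomputable def nodeSet {n : ℕ} (k : Fin n → ℕ) : Finset (Σ _ : Fin n, ℕ) :=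
  Finset.univ.sigma fun t => Finset.range (k t + 1)

/-- The product of the differences between the node `x_s q^l` and all the other nodes; its inverse
is the Lagrange weight of that node. -/
noncomputable def nodeDen {n : ℕ} (q : ℂ) (x : Fin n → ℂ) (k : Fin n → ℕ) (s : Fin n) (l : ℕ) : ℂ :=
  ∏ p ∈ (nodeSet k).erase ⟨s, l⟩, (x s * q ^ l - x p.1 * q ^ p.2)

theorem injective_geom_node {n : ℕ} {q : ℂ} {x : Fin n → ℂ} (hq0 : q ≠ 0) (hq1 : ‖q‖ < 1)
    (hx0 : ∀ r, x r ≠ 0) (hx : ∀ r s, r ≠ s → ∀ j : ℕ, x r * q ^ j ≠ x s) :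
    Function.Injective fun p : Σ _ : Fin n, ℕ => x p.1 * q ^ p.2 := by
  have aux : ∀ r s i j, i ≤ j → x r * q ^ i = x s * q ^ j → r = s := by
    intro r s i j hij h
    by_contra hrs
    refine hx s r (Ne.symm hrs) (j - i) (mul_right_cancel₀ (pow_ne_zero i hq0) ?_)
    rw [mul_assoc, ← pow_add, Nat.sub_add_cancel hij, h]
  rintro ⟨r, i⟩ ⟨s, j⟩ h
  simp only at h
  obtain rfl : r = s := by
    rcases le_total i j with hij | hij
    · exact aux _ _ _ _ hij h
    · exact (aux _ _ _ _ hij h.symm).symm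
  have h1 := congrArg norm (mul_left_cancel₀ (hx0 r) h)
  rw [norm_pow, norm_pow] at h1
  rw [pow_right_injective₀ (norm_pos_iff.2 hq0) hq1.ne h1]

theorem qRising_q_mul_div_ne_zero {n : ℕ} {q : ℂ} {x : Fin n → ℂ} (hq0 : q ≠ 0) (hq1 : ‖q‖ < 1)
    (hx0 : ∀ r, x r ≠ 0) (hx : ∀ r s, r ≠ s → ∀ j : ℕ, x r * q ^ j ≠ x s) (r s : Fin n) (l : ℕ) :
    qRising q (q * (x r / x s)) l ≠ 0 := by
  refine qRising_ne_zero fun i _ h => ?_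
  have := @injective_geom_node n q x hq0 hq1 hx0 hx ⟨r, i + 1⟩ ⟨s, 0⟩ (by
    have := hx0 s
    field_simp at h
    simp only [pow_zero, mul_one]
    linear_combination h)
  have := congrArg Sigma.snd this
  simp at this

theorem nodeDen_ne_zero {n : ℕ} {q : ℂ} {x : Fin n → ℂ} (hq0 : q ≠ 0) (hq1 : ‖q‖ < 1)
    (hx0 : ∀ r, x r ≠ 0) (hx : ∀ r s, r ≠ s → ∀ j : ℕ, x r * q ^ j ≠ x s)
    (k : Fin n → ℕ) (s : Fin n) (l : ℕ) : nodeDen q x k s l ≠ 0 := by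
  refine Finset.prod_ne_zero_iff.2 fun p hp => sub_ne_zero.2 fun h => ?_
  exact (Finset.mem_erase.1 hp).1 (@injective_geom_node n q x hq0 hq1 hx0 hx ⟨s, l⟩ p h).symm

/-- Within each row `s`, the weights `nodeWeight` are proportional to the Lagrange weights of the
full set of nodes, with a constant that depends on `s` only. -/
theorem nodeWeight_eq_div {n : ℕ} {q : ℂ} {x : Fin n → ℂ} (hq0 : q ≠ 0) (hq1 : ‖q‖ < 1)
    (hx0 : ∀ r, x r ≠ 0) (hx : ∀ r s, r ≠ s → ∀ j : ℕ, x r * q ^ j ≠ x s)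
    {k : Fin n → ℕ} {s : Fin n} {l : ℕ} (hl : l ≤ k s) :
    nodeWeight q x k s l = nodeDen q x k s 0 / nodeDen q x k s l := by
  rw [eq_div_iff (nodeDen_ne_zero hq0 hq1 hx0 hx k s l)]
  have hD : ∀ l, nodeDen q x k s l
      = (∏ j ∈ (Finset.range (k s + 1)).erase l, (x s * q ^ l - x s * q ^ j))
        * ∏ t ∈ {s}ᶜ, ∏ j ∈ Finset.range (k t + 1), (x s * q ^ l - x t * q ^ j) := fun l =>
    prod_sigma_erase (fun t => Finset.range (k t + 1))
      (fun t j => x s * q ^ l - x t * q ^ j) s l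
  rw [hD, hD, nodeWeight, Fintype.prod_eq_mul_prod_compl s, div_self (hx0 s), mul_one, mul_one]
  have h1 := prod_erase_sub_geom_mul_qRising (z := x s) hq0 hl
  have h1' : qRising q q l ≠ 0 := by
    simpa [hx0 s] using qRising_q_mul_div_ne_zero hq0 hq1 hx0 hx s s l
  have h2 : (∏ t ∈ {s}ᶜ, qRising q (q ^ (-(k t : ℤ)) * (x s / x t)) l
        / qRising q (q * (x s / x t)) l)
        * ∏ t ∈ {s}ᶜ, ∏ j ∈ Finset.range (k t + 1), (x s * q ^ l - x t * q ^ j)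
      = ∏ t ∈ {s}ᶜ, ∏ j ∈ Finset.range (k t + 1), (x s - x t * q ^ j) := by
    rw [← Finset.prod_mul_distrib]
    refine Finset.prod_congr rfl fun t _ => ?_
    rw [div_mul_eq_mul_div, div_eq_iff (qRising_q_mul_div_ne_zero hq0 hq1 hx0 hx s t l),
      mul_comm, prod_sub_geom_mul_qRising hq0 (hx0 t), mul_comm]
  simp only [pow_zero, mul_one]
  have h3 : q ^ l * (qRising q (q ^ (-(k s : ℤ))) l / qRising q q l)
        * ∏ j ∈ (Finset.range (k s + 1)).erase l, (x s * q ^ l - x s * q ^ j)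
      = ∏ j ∈ (Finset.range (k s + 1)).erase 0, (x s - x s * q ^ j) := by
    rw [mul_div_assoc', div_mul_eq_mul_div, div_eq_iff h1']
    linear_combination h1
  rw [← h2, ← h3]
  ring

open Polynomial in
/-- The sum is the determinant of the matrix with entries
`∑_l nodeWeight s l * P (x_s q^l) * (x_s q^l)^j`. Its rows, scaled by `(nodeDen s 0)⁻¹`, add up to
the divided difference of `P X^j` at all `n + |k|` nodes, and `P X^j` has degree at most
`n + |k| - 2`. -/
theorem sum_nodeWeight_mul_det_vandermonde_eq_zero {n : ℕ} {q : ℂ} {x : Fin n → ℂ}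
    (hq0 : q ≠ 0) (hq1 : ‖q‖ < 1)
    (hx0 : ∀ r, x r ≠ 0) (hx : ∀ r s, r ≠ s → ∀ j : ℕ, x r * q ^ j ≠ x s)
    {k : Fin n → ℕ} {P : ℂ[X]} (hP : P.natDegree < multiSize k) :
    ∑ l ∈ Finset.Iic k, (∏ s, nodeWeight q x k s (l s) * P.eval (x s * q ^ l s))
      * (Matrix.vandermonde fun s => x s * q ^ l s).det = 0 := by
  have hbox : Finset.Iic k = Fintype.piFinset fun s => Finset.range (k s + 1) := by
    ext l
    simp [Pi.le_def]
  rw [hbox]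
  refine sum_piFinset_det_vandermonde_eq_zero (fun s => Finset.range (k s + 1))
    (fun s l => x s * q ^ l) (fun s l => nodeWeight q x k s l * P.eval (x s * q ^ l))
    (c := fun s => (nodeDen q x k s 0)⁻¹) ?_ fun j hj => ?_
  · obtain ⟨s, -, -⟩ := Finset.exists_ne_zero_of_sum_ne_zero (Nat.ne_zero_of_lt hP)
    exact fun h => inv_ne_zero (nodeDen_ne_zero hq0 hq1 hx0 hx k s 0) (congrFun h s)
  · have hcard : (nodeSet k).card = multiSize k + n := by
      simp [nodeSet, multiSize, Finset.sum_add_distrib]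
    have hdeg : (P * X ^ j).natDegree + 1 < (nodeSet k).card := by
      have := natDegree_mul_le (p := P) (q := X ^ j)
      rw [natDegree_X_pow] at this
      omega
    rw [← sum_lagrange_weight_eq_zero (injective_geom_node hq0 hq1 hx0 hx).injOn hdeg, nodeSet,
      Finset.sum_sigma]
    refine Finset.sum_congr rfl fun s _ => ?_
    rw [Finset.mul_sum]
    refine Finset.sum_congr rfl fun l hl => ?_
    rw [nodeWeight_eq_div hq0 hq1 hx0 hx (Nat.lt_succ_iff.1 (Finset.mem_range.1 hl))]
    have h0 := nodeDen_ne_zero hq0 hq1 hx0 hx k s 0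
    change _ = _ / nodeDen q x k s l
    simp only [eval_mul, eval_pow, eval_X]
    field_simp

/-! ### The off-diagonal entries of the product -/

theorem sum_sum_Ioi {n : ℕ} (l : Fin n → ℕ) :
    ∑ r : Fin n, ∑ s ∈ Finset.Ioi r, l s = ∑ r : Fin n, (r : ℕ) * l r := by
  rw [Finset.sum_comm' (t' := Finset.univ) (s' := fun s => Finset.Iio s) (by simp)]
  refine Finset.sum_congr rfl fun s _ => ?_
  rw [Finset.sum_const, Fin.card_Iio, smul_eq_mul]

/-- The factor `q ^ ∑ r l_r` clears the denominators of `∏_{r<s} (1 - y_r / y_s)`,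
where `y_s = x_s q^{l_s}`. -/
theorem vandermondeA_mul_det {n : ℕ} {q : ℂ} {x : Fin n → ℂ} (hq0 : q ≠ 0)
    (hx0 : ∀ r, x r ≠ 0) (hx : ∀ r s, r ≠ s → x r ≠ x s) (l : Fin n → ℕ) :
    vandermondeA q x l * q ^ (∑ r : Fin n, (r : ℕ) * l r) * (Matrix.vandermonde x).det
      = (Matrix.vandermonde fun s => x s * q ^ l s).det := by
  rw [Matrix.det_vandermonde, Matrix.det_vandermonde, vandermondeA, ← sum_sum_Ioi]
  simp only [← Finset.prod_pow_eq_pow_sum, ← Finset.prod_mul_distrib]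
  refine Finset.prod_congr rfl fun r _ => Finset.prod_congr rfl fun s hs => ?_
  have hs0 := hx0 s
  have hrs : x s - x r ≠ 0 := sub_ne_zero.2 (hx s r (Finset.mem_Ioi.1 hs).ne')
  have : 1 - x r / x s ≠ 0 := by
    rw [one_sub_div hs0]
    exact div_ne_zero hrs hs0
  rw [zpow_sub₀ hq0, zpow_natCast, zpow_natCast]
  field_simp

/-- The power `q ^ (|l| |m|)` turns the rising factorials in `F_{lm}` into a product over `s` of
values at `x_s q^{l_s}` of one polynomial of degree `|m|`. -/
theorem prod_qRising_zpow_neg {n : ℕ} {q : ℂ} {x : Fin n → ℂ} (hq0 : q ≠ 0)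
    (hx0 : ∀ r, x r ≠ 0) (l m : Fin n → ℕ) :
    q ^ (multiSize l * multiSize m)
        * ∏ r, ∏ s, qRising q (q ^ (-(l s : ℤ)) * (x r / x s)) (m r)
      = (∏ s, x s ^ multiSize m)⁻¹
        * ∏ s, ∏ r, ∏ i ∈ Finset.range (m r), (x s * q ^ l s - x r * q ^ i) := by
  rw [Finset.prod_comm]
  have e : ∀ z : ℂ, z ^ multiSize m = ∏ r, ∏ _i ∈ Finset.range (m r), z := by
    intro z
    rw [multiSize, ← Finset.prod_pow_eq_pow_sum]
    simp
  have e2 : q ^ (multiSize l * multiSize m) = ∏ s, (q ^ l s) ^ multiSize m := by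
    rw [pow_mul, Finset.prod_pow, multiSize, Finset.prod_pow_eq_pow_sum]
  rw [e2, ← Finset.prod_inv_distrib]
  simp only [e, ← Finset.prod_inv_distrib, ← Finset.prod_mul_distrib, qRising]
  refine Finset.prod_congr rfl fun s _ => Finset.prod_congr rfl fun r _ =>
    Finset.prod_congr rfl fun i _ => ?_
  have := hx0 s
  rw [zpow_neg, zpow_natCast]
  field_simp

/-- The `a`-dependent denominators of `G_{kl}` and `F_{lm}` cancel when `|m| < |k|`, leaving a
polynomial of degree `|k| - |m| - 1`. -/
theorem qRising_div_mul_div {q b : ℂ} (hb : ∀ j : ℕ, b * q ^ j ≠ 1) {M N : ℕ} (h : M < N) :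
    qRising q b N / (1 - b) / qRising q (b * q) M
      = ∏ i ∈ Finset.range (N - M - 1), (1 - b * q ^ (M + 1 + i)) := by
  obtain ⟨d, rfl⟩ : ∃ d, N = 1 + M + d := ⟨N - M - 1, by omega⟩
  have h1 : 1 - b ≠ 0 := sub_ne_zero.2 (by simpa using (hb 0).symm)
  have h2 : qRising q (b * q) M ≠ 0 := qRising_ne_zero fun i _ => by
    simpa [mul_assoc, pow_succ'] using hb (i + 1)
  rw [qRising_add, qRising_add, show 1 + M + d - M - 1 = d by omega]
  have e1 : qRising q b 1 = 1 - b := by simp [qRising]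
  have e2 : qRising q (b * q ^ (1 + M)) d
      = ∏ i ∈ Finset.range d, (1 - b * q ^ (M + 1 + i)) := by
    simp only [qRising, pow_add, mul_left_comm, mul_comm]
  rw [e1, e2, pow_one]
  field_simp

open Polynomial in
/-- The polynomial `P` of one variable such that, up to a factor independent of `l`, all that
`G_{kl} F_{lm}` contains besides `nodeWeight` and the Vandermonde determinant is
`∏_s P (x_s q^{l_s})`. The truncated subtraction is harmless as it is used for `|m| < |k|` only. -/
noncomputable def baileyPoly {n : ℕ} (q a : ℂ) (x : Fin n → ℂ) (k m : Fin n → ℕ) : ℂ[X] :=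
  (∏ r, ∏ i ∈ Finset.range (m r), (X - C (x r * q ^ i)))
    * ∏ i ∈ Finset.range (multiSize k - multiSize m - 1),
        (1 - C (a * q ^ (multiSize m + 1 + i)) * X)

open Polynomial in
theorem natDegree_baileyPoly_lt {n : ℕ} (q a : ℂ) (x : Fin n → ℂ) {k m : Fin n → ℕ}
    (h : multiSize m < multiSize k) : (baileyPoly q a x k m).natDegree < multiSize k := by
  have h1 : (∏ r, ∏ i ∈ Finset.range (m r), (X - C (x r * q ^ i))).natDegree ≤ multiSize m := by
    refine (natDegree_prod_le _ _).trans (Finset.sum_le_sum fun r _ => ?_)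
    refine (natDegree_prod_le _ _).trans ?_
    simp only [natDegree_X_sub_C, Finset.sum_const, Finset.card_range, smul_eq_mul, mul_one,
      le_refl]
  have h2 : (∏ i ∈ Finset.range (multiSize k - multiSize m - 1),
      (1 - C (a * q ^ (multiSize m + 1 + i)) * X)).natDegree ≤ multiSize k - multiSize m - 1 := by
    refine (natDegree_prod_le _ _).trans ?_
    refine (Finset.sum_le_card_nsmul _ _ 1 fun i _ => ?_).trans (by simp)
    compute_degree
  have := natDegree_mul_le_of_le h1 h2
  rw [baileyPoly]
  omega

theorem baileyG_mul_baileyF_eq {n : ℕ} {q a : ℂ} {x : Fin n → ℂ}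
    (hq0 : q ≠ 0) (hx0 : ∀ r, x r ≠ 0) (hx : ∀ r s, r ≠ s → x r ≠ x s)
    (ha : ∀ r, ∀ j : ℕ, a * x r * q ^ j ≠ 1) {k m : Fin n → ℕ}
    (h : multiSize m < multiSize k) :
    ∃ c : ℂ, ∀ l, baileyG q a x k l * baileyF q a x l m
      = c * ((∏ s, nodeWeight q x k s (l s) * (baileyPoly q a x k m).eval (x s * q ^ l s))
          * (Matrix.vandermonde fun s => x s * q ^ l s).det) := by
  have hV : (Matrix.vandermonde x).det ≠ 0 := Matrix.det_vandermonde_ne_zero_iff.2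
    fun r s hrs => by_contra fun hne => hx r s hne hrs
  refine ⟨(Matrix.vandermonde x).det⁻¹ * (∏ r, ∏ s, qRising q (q * (x r / x s)) (k r))⁻¹
    * vandermondeA q x m * q ^ (∑ r : Fin n, (r : ℕ) * m r) * (∏ s, x s ^ multiSize m)⁻¹
    * ∏ r, (1 - a * x r * q ^ (m r + multiSize m)), fun l => ?_⟩
  have hv : vandermondeA q x l * q ^ (∑ r : Fin n, (r : ℕ) * l r)
      = (Matrix.vandermonde x).det⁻¹ * (Matrix.vandermonde fun s => x s * q ^ l s).det := by
    rw [eq_inv_mul_iff_mul_eq₀ hV, mul_comm]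
    exact vandermondeA_mul_det hq0 hx0 hx l
  have hP : ∏ s, (baileyPoly q a x k m).eval (x s * q ^ l s)
      = (∏ s, ∏ r, ∏ i ∈ Finset.range (m r), (x s * q ^ l s - x r * q ^ i))
        * ∏ s, qRising q (a * x s * q ^ l s) (multiSize k) / (1 - a * x s * q ^ l s)
          / qRising q (a * x s * q ^ (l s + 1)) (multiSize m) := by
    rw [← Finset.prod_mul_distrib]
    refine Finset.prod_congr rfl fun s _ => ?_
    rw [pow_succ, ← mul_assoc (a * x s), qRising_div_mul_div (fun j => by
      rw [mul_assoc, ← pow_add]; exact ha s _) h]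
    simp only [baileyPoly, Polynomial.eval_mul, Polynomial.eval_prod, Polynomial.eval_sub,
      Polynomial.eval_X, Polynomial.eval_C, Polynomial.eval_one]
    congr 1
    refine Finset.prod_congr rfl fun i _ => by ring
  have hB := prod_qRising_zpow_neg hq0 hx0 l m
  have hW : vandermondeA q x l * (q ^ (∑ r : Fin n, ((r : ℕ) + 1) * l r)
      * ∏ r, ∏ s, qRising q (q ^ (-(k s : ℤ)) * (x r / x s)) (l r)
            / (qRising q (q * (x r / x s)) (k r) * qRising q (q * (x r / x s)) (l r)))
      = (Matrix.vandermonde x).det⁻¹ * (Matrix.vandermonde fun s => x s * q ^ l s).det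
        * (∏ r, ∏ s, qRising q (q * (x r / x s)) (k r))⁻¹
        * ∏ s, nodeWeight q x k s (l s) := by
    rw [← hv]
    simp only [add_mul, one_mul, Finset.sum_add_distrib, pow_add, nodeWeight,
      ← Finset.prod_pow_eq_pow_sum, Finset.prod_mul_distrib, Finset.prod_div_distrib]
    rw [div_mul_eq_div_div]
    ring
  rw [baileyG, baileyF, Finset.prod_mul_distrib, hP]
  calc _ = vandermondeA q x l * (q ^ (∑ r : Fin n, ((r : ℕ) + 1) * l r)
      * ∏ r, ∏ s, qRising q (q ^ (-(k s : ℤ)) * (x r / x s)) (l r)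
            / (qRising q (q * (x r / x s)) (k r) * qRising q (q * (x r / x s)) (l r)))
      * (∏ r : Fin n, qRising q (a * x r * q ^ (l r)) (multiSize k) / (1 - a * x r * q ^ (l r)))
      * (vandermondeA q x m * q ^ (∑ r : Fin n, (r : ℕ) * m r)
        * (q ^ (multiSize l * multiSize m)
          * ∏ r, ∏ s, qRising q (q ^ (-(l s : ℤ)) * (x r / x s)) (m r))
        * ∏ r : Fin n, (1 - a * x r * q ^ (m r + multiSize m))
          / qRising q (a * x r * q ^ (l r + 1)) (multiSize m)) := by ring
    _ = _ := by
      rw [hW, hB]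
      simp only [Finset.prod_div_distrib]
      ring

/-! ### Symmetry of the rising factorials -/

/-- The joint contribution of the pairs `(r, s)` and `(s, r)` to a diagonal entry, with `A = k_r`,
`B = k_s` and `c = x_r / x_s`. -/
theorem qRising_pair {q c : ℂ} (hq : q ≠ 0) (hc : c ≠ 0) (A B : ℕ) :
    (1 - q ^ ((A : ℤ) - (B : ℤ)) * c)
        * (qRising q (q ^ (-(B : ℤ)) * c) A * qRising q (q ^ (-(A : ℤ)) * c⁻¹) B)
        * q ^ ((A + 1) * B)
      = (1 - c) * (qRising q (q * c) A * qRising q (q * c⁻¹) B) := by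
  -- Both sides are `∏ (1 - q ^ e * c)` over the exponents `-B ≤ e ≤ A`, split at `e = A - B` on the
  -- left and at `e = 0` on the right.
  have h1 : qRising q (q ^ (-(B : ℤ)) * c) A * (1 - q ^ ((A : ℤ) - (B : ℤ)) * c)
        * qRising q (q ^ ((A : ℤ) - B + 1) * c) B
      = qRising q (q ^ (-(B : ℤ)) * c) B * (1 - c) * qRising q (q * c) A := by
    have e1 := qRising_add q (q ^ (-(B : ℤ)) * c) (A + 1) B
    have e2 := qRising_add q (q ^ (-(B : ℤ)) * c) (B + 1) A
    rw [qRising_succ] at e1 e2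
    rw [show A + 1 + B = B + 1 + A by omega, e2] at e1
    have z1 : q ^ (-(B : ℤ)) * c * q ^ A = q ^ ((A : ℤ) - (B : ℤ)) * c := by
      rw [sub_eq_neg_add, zpow_add₀ hq, zpow_natCast]; ring
    have z2 : q ^ (-(B : ℤ)) * c * q ^ (A + 1) = q ^ ((A : ℤ) - B + 1) * c := by
      rw [pow_succ, ← mul_assoc, z1, zpow_add_one₀ hq]; ring
    have z3 : q ^ (-(B : ℤ)) * c * q ^ B = c := by
      rw [zpow_neg, zpow_natCast]; field_simp
    have z4 : q ^ (-(B : ℤ)) * c * q ^ (B + 1) = q * c := by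
      rw [pow_succ, ← mul_assoc, z3, mul_comm]
    rw [z1, z2, z3, z4] at e1
    exact e1.symm
  have r1 := qRising_reverse hq (mul_ne_zero (zpow_ne_zero (-(A : ℤ)) hq) (inv_ne_zero hc)) B
  have r2 := qRising_reverse hq (mul_ne_zero hq (inv_ne_zero hc)) B
  have w1 : q ^ (1 - (B : ℤ)) * (q ^ (-(A : ℤ)) * c⁻¹)⁻¹ = q ^ ((A : ℤ) - B + 1) * c := by
    rw [mul_inv, inv_inv, ← zpow_neg, neg_neg, ← mul_assoc, ← zpow_add₀ hq]
    congr 2; ring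
  have w2 : q ^ (1 - (B : ℤ)) * (q * c⁻¹)⁻¹ = q ^ (-(B : ℤ)) * c := by
    rw [mul_inv, inv_inv, sub_eq_neg_add, zpow_add_one₀ hq]
    field_simp
  have w3 : (-(q ^ (-(A : ℤ)) * c⁻¹)) ^ B * q ^ ((A + 1) * B) = (-(q * c⁻¹)) ^ B := by
    rw [pow_mul, ← mul_pow, zpow_neg, zpow_natCast, pow_succ]
    congr 1
    field_simp
  rw [w1] at r1
  rw [w2] at r2
  rw [r1, r2, ← w3]
  linear_combination (-(q ^ (-(A : ℤ)) * c⁻¹)) ^ B * q ^ ((A + 1) * B)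
    * q ^ (∑ i ∈ Finset.range B, i) * h1

theorem qRising_zpow_neg_self {q : ℂ} (hq : q ≠ 0) (A : ℕ) :
    qRising q (q ^ (-(A : ℤ))) A ^ 2 * q ^ (A * (A + 1)) = qRising q q A ^ 2 := by
  have h := qRising_reverse hq (zpow_ne_zero (-(A : ℤ)) hq) A
  have e : q ^ (1 - (A : ℤ)) * (q ^ (-(A : ℤ)))⁻¹ = q := by
    rw [← zpow_neg, ← zpow_add₀ hq]; simp
  rw [e] at h
  have hT : (∑ i ∈ Finset.range A, i) * 2 + A * (A + 1) = A * (2 * A) := by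
    rw [Finset.sum_range_id_mul_two]
    cases A with
    | zero => rfl
    | succ A => rw [Nat.add_sub_cancel]; ring
  have hz : q ^ (-(A : ℤ)) * q ^ A = 1 := by
    rw [zpow_neg, zpow_natCast, inv_mul_cancel₀ (pow_ne_zero _ hq)]
  calc qRising q (q ^ (-(A : ℤ))) A ^ 2 * q ^ (A * (A + 1))
      = (-q ^ (-(A : ℤ))) ^ (2 * A) * q ^ ((∑ i ∈ Finset.range A, i) * 2 + A * (A + 1))
        * qRising q q A ^ 2 := by rw [h]; ring
    _ = (q ^ (-(A : ℤ)) * q ^ A) ^ (2 * A) * qRising q q A ^ 2 := by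
      rw [hT, (even_two_mul A).neg_pow, pow_mul q A, mul_pow]
    _ = qRising q q A ^ 2 := by rw [hz, one_pow, one_mul]

/-! ### The inverse relation -/

@[to_additive]
theorem prod_prod_eq_diag_mul_Ioi {n : ℕ} {M : Type*} [CommMonoid M] (f : Fin n → Fin n → M) :
    ∏ i, ∏ j, f i j = (∏ i, f i i) * ∏ i, ∏ j ∈ Finset.Ioi i, f i j * f j i := by
  rw [Finset.prod_prod_Ioi_mul_eq_prod_prod_off_diag (fun j i => f i j),
    ← Finset.prod_mul_distrib]
  exact Finset.prod_congr rfl fun i _ => Fintype.prod_eq_mul_prod_compl i _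

/-- The Vandermonde factor cancels against the off-diagonal pairs of rising factorials
(`qRising_pair`), so only a power of `q` and signs remain. The power is `0`, and the signs are
squared because `F` and `G` contain the same rising factorials. -/
theorem baileyG_mul_baileyF_diag {n : ℕ} {q a : ℂ} {x : Fin n → ℂ}
    (hq0 : q ≠ 0) (hq1 : ‖q‖ < 1)
    (hx0 : ∀ r, x r ≠ 0) (hx : ∀ r s, r ≠ s → ∀ j : ℕ, x r * q ^ j ≠ x s)
    (ha : ∀ r, ∀ j : ℕ, a * x r * q ^ j ≠ 1) (k : Fin n → ℕ) :
    baileyG q a x k k * baileyF q a x k k = 1 := by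
  have hb := qRising_q_mul_div_ne_zero hq0 hq1 hx0 hx
  set α : Fin n → Fin n → ℂ := fun r s => qRising q (q ^ (-(k s : ℤ)) * (x r / x s)) (k r) with hα
  set β : Fin n → Fin n → ℂ := fun r s => qRising q (q * (x r / x s)) (k r) with hβ
  have hβ0 : ∀ r s, β r s ≠ 0 := fun r s => hb r s _
  have hdiag : (∏ r, α r r / β r r) ^ 2 * q ^ (∑ r, k r * (k r + 1)) = 1 := by
    rw [← Finset.prod_pow_eq_pow_sum, ← Finset.prod_pow, ← Finset.prod_mul_distrib]
    refine Finset.prod_eq_one fun r _ => ?_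
    have h1 := qRising_zpow_neg_self hq0 (k r)
    have h2 := hβ0 r r
    simp only [hα, hβ, div_self (hx0 r), mul_one] at h2 ⊢
    rw [div_pow, div_mul_eq_mul_div, h1, div_self (pow_ne_zero _ h2)]
  have hoff : vandermondeA q x k * (∏ r, ∏ s ∈ Finset.Ioi r, α r s / β r s * (α s r / β s r))
      * q ^ (∑ r, ∑ s ∈ Finset.Ioi r, (k r + 1) * k s) = 1 := by
    simp only [vandermondeA, ← Finset.prod_pow_eq_pow_sum, ← Finset.prod_mul_distrib]
    refine Finset.prod_eq_one fun r _ => Finset.prod_eq_one fun s hs => ?_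
    have hrs : r ≠ s := (Finset.mem_Ioi.1 hs).ne
    have h1 := qRising_pair hq0 (div_ne_zero (hx0 r) (hx0 s)) (k r) (k s)
    rw [inv_div] at h1
    change _ * (α r s * α s r) * _ = _ * (β r s * β s r) at h1
    have h2 := hβ0 r s
    have h3 := hβ0 s r
    have h4 : 1 - x r / x s ≠ 0 := by
      rw [one_sub_div (hx0 s)]
      exact div_ne_zero (sub_ne_zero.2 (by simpa using hx s r hrs.symm 0)) (hx0 s)
    rw [div_mul_div_comm, div_mul_div_comm, div_mul_eq_mul_div, h1,
      div_self (mul_ne_zero h4 (mul_ne_zero h2 h3))]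
  -- The exponents of `q` in the diagonal entry add up to those of `hoff` (squared) and `hdiag`.
  have hexp : (∑ r : Fin n, ((r : ℕ) + 1) * k r) + (∑ r : Fin n, (r : ℕ) * k r)
        + multiSize k * multiSize k
      = 2 * (∑ r, ∑ s ∈ Finset.Ioi r, (k r + 1) * k s) + ∑ r, k r * (k r + 1) := by
    rw [multiSize, Finset.sum_mul_sum, sum_sum_eq_diag_add_Ioi]
    simp only [mul_add, mul_one, Finset.sum_add_distrib, sum_sum_Ioi,
      mul_comm]
    ring
  have hlast : ∏ r : Fin n, qRising q (a * x r * q ^ (k r)) (multiSize k)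
          / (1 - a * x r * q ^ (k r))
        * ((1 - a * x r * q ^ (k r + multiSize k))
          / qRising q (a * x r * q ^ (k r + 1)) (multiSize k)) = 1 := by
    refine Finset.prod_eq_one fun r _ => ?_
    have h1 : qRising q (a * x r * q ^ (k r)) (multiSize k)
          * (1 - a * x r * q ^ (k r + multiSize k))
        = (1 - a * x r * q ^ (k r)) * qRising q (a * x r * q ^ (k r + 1)) (multiSize k) := by
      have e1 := qRising_succ q (a * x r * q ^ (k r)) (multiSize k)
      rw [add_comm, qRising_add] at e1
      simp only [mul_assoc, pow_succ, pow_add] at e1 ⊢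
      rw [← e1]
      simp [qRising, mul_assoc]
    have h2 : 1 - a * x r * q ^ (k r) ≠ 0 := sub_ne_zero.2 (ha r _).symm
    have h3 : qRising q (a * x r * q ^ (k r + 1)) (multiSize k) ≠ 0 :=
      qRising_ne_zero fun i _ => by rw [mul_assoc, ← pow_add]; exact ha r _
    rw [div_mul_div_comm, h1, div_self (mul_ne_zero h2 h3)]
  have hall : ∏ r, ∏ s, α r s / β r s
      = (∏ r, α r r / β r r) * ∏ r, ∏ s ∈ Finset.Ioi r, α r s / β r s * (α s r / β s r) :=
    prod_prod_eq_diag_mul_Ioi fun r s => α r s / β r s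
  have hG : ∏ r, ∏ s, α r s / (β r s * β r s)
      = (∏ r, ∏ s, α r s / β r s) * (∏ r, ∏ s, β r s)⁻¹ := by
    simp only [← Finset.prod_inv_distrib, ← Finset.prod_mul_distrib]
    refine Finset.prod_congr rfl fun r _ => Finset.prod_congr rfl fun s _ => by
      rw [div_mul_eq_div_div, div_eq_mul_inv (α r s / β r s)]
  have hF : ∏ r, ∏ s, α r s = (∏ r, ∏ s, α r s / β r s) * (∏ r, ∏ s, β r s) := by
    simp only [← Finset.prod_mul_distrib]
    refine Finset.prod_congr rfl fun r _ => Finset.prod_congr rfl fun s _ => by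
      rw [div_mul_cancel₀ _ (hβ0 r s)]
  have hB0 : ∏ r, ∏ s, β r s ≠ 0 :=
    Finset.prod_ne_zero_iff.2 fun r _ => Finset.prod_ne_zero_iff.2 fun s _ => hβ0 r s
  rw [Finset.prod_mul_distrib] at hlast
  simp only [baileyG, baileyF]
  change vandermondeA q x k * _ * (∏ r, ∏ s, α r s / (β r s * β r s)) * _
    * (vandermondeA q x k * _ * _ * (∏ r, ∏ s, α r s) * _) = 1
  rw [hG, hF]
  generalize ∏ r, ∏ s, β r s = b at hB0 ⊢
  rw [hall]
  generalize ∏ r, ∏ s ∈ Finset.Ioi r, α r s / β r s * (α s r / β s r) = u at hoff ⊢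
  generalize ∏ r, α r r / β r r = d at hdiag ⊢
  generalize vandermondeA q x k = v at hoff ⊢
  calc _ = v ^ 2 * u ^ 2 * d ^ 2 * (b⁻¹ * b) * (q ^ (∑ r : Fin n, ((r : ℕ) + 1) * k r)
        * q ^ (∑ r : Fin n, (r : ℕ) * k r) * q ^ (multiSize k * multiSize k))
        * ((∏ r : Fin n, qRising q (a * x r * q ^ (k r)) (multiSize k) / (1 - a * x r * q ^ (k r)))
        * ∏ r : Fin n, ((1 - a * x r * q ^ (k r + multiSize k))
          / qRising q (a * x r * q ^ (k r + 1)) (multiSize k))) := by ring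
    _ = (v * u * q ^ (∑ r, ∑ s ∈ Finset.Ioi r, (k r + 1) * k s)) ^ 2
        * (d ^ 2 * q ^ (∑ r, k r * (k r + 1))) := by
      rw [hlast, inv_mul_cancel₀ hB0, ← pow_add, ← pow_add, hexp, pow_add, pow_mul']
      ring
    _ = 1 := by rw [hoff, hdiag]; norm_num

theorem exists_diag_qRising_eq_zero {n : ℕ} {q : ℂ} {x : Fin n → ℂ}
    (hq0 : q ≠ 0) (hx0 : ∀ r, x r ≠ 0) {k m : Fin n → ℕ} (h : ¬ ∀ r, m r ≤ k r) :
    ∃ r, qRising q (q ^ (-(k r : ℤ)) * (x r / x r)) (m r) = 0 := by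
  push Not at h
  obtain ⟨r, hr⟩ := h
  exact ⟨r, by rw [div_self (hx0 r), mul_one, qRising_zpow_neg_eq_zero hq0 hr]⟩

theorem multiLowerTriangular_baileyF {n : ℕ} {q : ℂ} (a : ℂ) {x : Fin n → ℂ}
    (hq0 : q ≠ 0) (hx0 : ∀ r, x r ≠ 0) : MultiLowerTriangular (baileyF q a x) := by
  intro k m h
  obtain ⟨r, hr⟩ := exists_diag_qRising_eq_zero hq0 hx0 h
  have : ∏ r : Fin n, ∏ s : Fin n, qRising q (q ^ (-(k s : ℤ)) * (x r / x s)) (m r) = 0 :=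
    Finset.prod_eq_zero (Finset.mem_univ r) (Finset.prod_eq_zero (Finset.mem_univ r) hr)
  rw [baileyF, this, mul_zero, zero_mul]

theorem multiLowerTriangular_baileyG {n : ℕ} {q : ℂ} (a : ℂ) {x : Fin n → ℂ}
    (hq0 : q ≠ 0) (hx0 : ∀ r, x r ≠ 0) : MultiLowerTriangular (baileyG q a x) := by
  intro k m h
  obtain ⟨r, hr⟩ := exists_diag_qRising_eq_zero hq0 hx0 h
  have : ∏ r : Fin n, ∏ s : Fin n, qRising q (q ^ (-(k s : ℤ)) * (x r / x s)) (m r)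
      / (qRising q (q * (x r / x s)) (k r) * qRising q (q * (x r / x s)) (m r)) = 0 :=
    Finset.prod_eq_zero (Finset.mem_univ r) (Finset.prod_eq_zero (Finset.mem_univ r)
      (by rw [hr, zero_div]))
  rw [baileyG, this, mul_zero, zero_mul]

theorem sum_baileyG_mul_baileyF {n : ℕ} {q a : ℂ} {x : Fin n → ℂ}
    (hq0 : q ≠ 0) (hq1 : ‖q‖ < 1)
    (hx0 : ∀ r, x r ≠ 0) (hx : ∀ r s, r ≠ s → ∀ j : ℕ, x r * q ^ j ≠ x s)
    (ha : ∀ r, ∀ j : ℕ, a * x r * q ^ j ≠ 1) (k m : Fin n → ℕ) :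
    ∑ l ∈ Finset.Iic k, baileyG q a x k l * baileyF q a x l m
      = (1 : Matrix (Fin n → ℕ) (Fin n → ℕ) ℂ) k m := by
  by_cases hkm : k = m
  · subst hkm
    rw [Matrix.one_apply_eq, ← baileyG_mul_baileyF_diag hq0 hq1 hx0 hx ha k]
    refine Finset.sum_eq_single_of_mem k (Finset.mem_Iic.2 le_rfl) fun l hl hlk => ?_
    rw [multiLowerTriangular_baileyF a hq0 hx0 l k
      fun h => hlk (le_antisymm (Finset.mem_Iic.1 hl) h), mul_zero]
  rw [Matrix.one_apply_ne hkm]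
  by_cases hle : m ≤ k
  · have hlt : multiSize m < multiSize k := by
      obtain ⟨-, r, hr⟩ := Pi.lt_def.1 (lt_of_le_of_ne hle (Ne.symm hkm))
      exact Finset.sum_lt_sum (fun r _ => hle r) ⟨r, Finset.mem_univ r, hr⟩
    obtain ⟨c, hc⟩ := baileyG_mul_baileyF_eq hq0 hx0
      (fun r s hrs => by simpa using hx r s hrs 0) ha hlt
    simp only [hc]
    rw [← Finset.mul_sum, sum_nodeWeight_mul_det_vandermonde_eq_zero hq0 hq1 hx0 hx
      (natDegree_baileyPoly_lt q a x hlt), mul_zero]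
  · refine Finset.sum_eq_zero fun l hl => ?_
    rw [multiLowerTriangular_baileyF a hq0 hx0 l m
      fun h => hle (le_trans (show m ≤ l from h) (Finset.mem_Iic.1 hl)), mul_zero]

theorem mainTheorem10 (n : ℕ) (q a : ℂ) (x : Fin n → ℂ)
    (hq0 : q ≠ 0) (hq1 : ‖q‖ < 1)
    (hx0 : ∀ r, x r ≠ 0)
    (hx : ∀ r s, r ≠ s → ∀ j : ℕ, x r * q ^ j ≠ x s)
    (ha : ∀ r, ∀ j : ℕ, a * x r * q ^ j ≠ 1) :
    (MultiLowerTriangular (baileyF q a x) ∧ MultiLowerTriangular (baileyG q a x)) ∧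
    (LexLowerTriangular (baileyF q a x) ∧ LexLowerTriangular (baileyG q a x)) ∧
    MulEqOne (baileyF q a x) (baileyG q a x) ∧
    MulEqOne (baileyG q a x) (baileyF q a x) := by
  have hF := multiLowerTriangular_baileyF a hq0 hx0
  have hG := multiLowerTriangular_baileyG a hq0 hx0
  exact ⟨⟨hF, hG⟩, ⟨hF.lexLowerTriangular, hG.lexLowerTriangular⟩,
    (mulEqOne_and_swap_of_multiLowerTriangular hG hF
      (sum_baileyG_mul_baileyF hq0 hq1 hx0 hx ha)).symm⟩
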